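/- Let $d\ge 1$, $L,\mu>0$, and let $f:\mathbb{R}^d\to\mathbb{R}$ be differentiable with $\|\nabla f(y)-\nabla f(x)\|\le L\|y-x\|$ and $\mu$-strongly convex, i.e. $f(y)\ge f(x)+\langle\nabla f(x),y-x\rangle+\frac{\mu}{2}\|y-x\|^2$, for all $x,y\in\mathbb{R}^d$. Then $f$ has a unique minimizer $x^*$. Given $x_0\in\mathbb{R}^d$, an integer $T\ge 1$ and $\alpha>0$, zeroth-order gradient descent draws independent $u_0,\dots,u_{T-1}\sim\mathcal{N}(0,I_d)$ and, for $t=0,\dots,T-1$, queries $f$ at $x_t+\alpha u_t$ and $x_t-\alpha u_t$ and sets $$x_{t+1}=x_t-\frac{1}{4L\|u_t\|^2}\cdot\frac{f(x_t+\alpha u_t)-f(x_t-\alpha u_t)}{2\alpha}\,u_t .$$ Write $\Delta_0=f(x_0)-f(x^*)$. There are universal constants $c,C>0$ such that the following holds for all such $d,L,\mu,f,x_0$ and all $0<\varepsilon<1$, $0<\delta<1$. (i) If the integer $T\ge1$ and $\alpha>0$ satisfy $$T\ \ge\ \frac{16dL}{\mu}\log\frac{2\Delta_0}{\varepsilon}+12\log\frac{3}{\delta},\qquad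 \alpha\ \le\ c\,\min\Bigl\{\frac{\sqrt{\varepsilon\mu}}{dL},\ \sqrt{\frac{\varepsilon}{dL\,(1+\log(1/\delta)+\log\log T)}}\Bigr\}$$ (where the first condition is void if $\Delta_0=0$, and $\log\log T$ is read as $0$ if $T=1$), then $f(x_T)-f(x^*)\le\varepsilon$ with probability at least $1-\delta$, and the run makes exactly $2T$ queries to $f$. (ii) There are $T$ and $\alpha$ satisfying the conditions in (i) for which the number of queries is at most $$C\Bigl(\frac{dL}{\mu}\bigl(1+\log\tfrac1\varepsilon+\max\{0,\log\Delta_0\}\bigr)+\log\tfrac1\delta\Bigr)$$ (with $\max\{0,\log\Delta_0\}$ read as $0$ if $\Delta_0=0$), i.e. $O\bigl(\frac{dL}{\mu}\log\frac1\varepsilon+\log\frac1\delta\bigr)$ as $\varepsilon\to0$ for bounded $\Delta_0$. -/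

import Mathlib

open MeasureTheory ProbabilityTheory

noncomputable section

namespace ZerothOrder

/-- A computation with query access to an unknown real function on `X`: it either stops with a
value, or asks for the function value at a point and continues depending on the answer. -/
inductive OracleAlg (X A : Type) : Type
  | done (a : A) : OracleAlg X A
  | query (x : X) (k : ℝ → OracleAlg X A) : OracleAlg X A

namespace OracleAlg

variable {X A B : Type}

/-- Sequential composition. -/
def bind : OracleAlg X A → (A → OracleAlg X B) → OracleAlg X B
  | done a, g => g a
  | query x k, g => query x (fun r => (k r).bind g)

/-- The value returned when the queries are answered by `f`. -/
def output (f : X → ℝ) : OracleAlg X A → A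
  | done a => a
  | query x k => (k (f x)).output f

/-- The number of queries made when the queries are answered by `f`. -/
def queries (f : X → ℝ) : OracleAlg X A → ℕ
  | done _ => 0
  | query x k => (k (f x)).queries f + 1

theorem output_bind (f : X → ℝ) (p : OracleAlg X A) (g : A → OracleAlg X B) :
    (p.bind g).output f = (g (p.output f)).output f := by
  induction p with
  | done a => rfl
  | query x k ih => exact ih (f x)

theorem queries_bind (f : X → ℝ) (p : OracleAlg X A) (g : A → OracleAlg X B) :
    (p.bind g).queries f = p.queries f + (g (p.output f)).queries f := by
  induction p with
  | done a => simp [bind, queries, output]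
  | query x k ih => simp only [bind, queries, output, ih]; omega

end OracleAlg

/-- One iteration: query at `x + α u` and `x - α u`, form the two-point estimator
`g = (f (x + α u) - f (x - α u)) / (2 α) • u`, and move to `x - η g` with the normalized stepsize
`η = 1 / (4 L ‖u‖²)`. -/
def zgdStep {d : ℕ} (L α : ℝ) (u x : EuclideanSpace ℝ (Fin d)) :
    OracleAlg (EuclideanSpace ℝ (Fin d)) (EuclideanSpace ℝ (Fin d)) :=
  .query (x + α • u) fun fplus =>
    .query (x - α • u) fun fminus =>
      .done (x - (1 / (4 * L * ‖u‖ ^ 2)) • (((fplus - fminus) / (2 * α)) • u))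

/-- Zeroth-order gradient descent with initial point `x₀`, smoothing radius `α`, smoothness
constant `L` and search directions `u 0, u 1, …`, run for `T` iterations; it returns `x_T`.
Only `u 0, …, u (T - 1)` are used. -/
def zgd {d : ℕ} (L α : ℝ) (u : ℕ → EuclideanSpace ℝ (Fin d)) (x₀ : EuclideanSpace ℝ (Fin d)) :
    ℕ → OracleAlg (EuclideanSpace ℝ (Fin d)) (EuclideanSpace ℝ (Fin d))
  | 0 => .done x₀
  | t + 1 => (zgd L α u x₀ t).bind (fun x => zgdStep L α (u t) x)

/-- The iterates satisfy `x_{t+1} = x_t - η_t g(x_t)`. -/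
theorem zgd_output_succ {d : ℕ} (f : EuclideanSpace ℝ (Fin d) → ℝ) (L α : ℝ)
    (u : ℕ → EuclideanSpace ℝ (Fin d)) (x₀ : EuclideanSpace ℝ (Fin d)) (t : ℕ) :
    (zgd L α u x₀ (t + 1)).output f =
      (zgd L α u x₀ t).output f -
        (1 / (4 * L * ‖u t‖ ^ 2)) •
          (((f ((zgd L α u x₀ t).output f + α • u t) -
              f ((zgd L α u x₀ t).output f - α • u t)) / (2 * α)) • u t) := by
  rw [zgd, OracleAlg.output_bind]
  rfl

/-- `f` is differentiable with `L`-Lipschitz gradient. -/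
def LipschitzGradient {d : ℕ} (L : ℝ) (f : EuclideanSpace ℝ (Fin d) → ℝ) : Prop :=
  Differentiable ℝ f ∧ ∀ x y, ‖gradient f y - gradient f x‖ ≤ L * ‖y - x‖

/-- `μ`-strong convexity of a differentiable function, in gradient form. -/
def StronglyConvex {d : ℕ} (μ : ℝ) (f : EuclideanSpace ℝ (Fin d) → ℝ) : Prop :=
  ∀ x y, f x + inner ℝ (gradient f x) (y - x) + μ / 2 * ‖y - x‖ ^ 2 ≤ f y

/-- The condition `T ≥ 1` and `T ≥ (16 d L / μ) log (2 Δ₀ / ε) + 12 log (3 / δ)`.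
For `Δ₀ = 0` the right-hand side is `-∞`, so only `T ≥ 1` is required. -/
def HorizonCondition (d : ℕ) (L μ Δ₀ ε δ : ℝ) (T : ℕ) : Prop :=
  1 ≤ T ∧
    (0 < Δ₀ → 16 * d * L / μ * Real.log (2 * Δ₀ / ε) + 12 * Real.log (3 / δ) ≤ (T : ℝ))

/-- The bound `min {√(ε μ) / (d L), √(ε / (d L (1 + log (1/δ) + log log T)))}`.
For `T = 1` the term `log log T` is read as `0` (which is what `Real.log 0` is). -/
def radiusBound (d : ℕ) (L μ ε δ : ℝ) (T : ℕ) : ℝ :=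
  min (√(ε * μ) / (d * L))
    √(ε / (d * L * (1 + Real.log (1 / δ) + Real.log (Real.log (T : ℝ)))))

end ZerothOrder

end

/-!
Write `Δ_t` for the optimality gap of `x_t`, `B_t` for the squared cosine of the angle between
`∇f(x_t)` and `u_t`, and `κ = μ / (4 L)`. Smoothness, convexity and the Polyak–Łojasiewicz
inequality give the pathwise recursion
`Δ_{t+1} ≤ (1 - κ B_t) Δ_t + q ‖u_t‖² / d` with `q = L α² d / 32` (`nextIterate_gap_le`): the
normalized stepsize makes the decrease depend on the direction of `u_t` only, and the second term is
the bias of the two-point estimator. Unrolled, this reads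
`Δ_T ≤ Δ_0 exp (-κ ∑ B_t) + q R_T`, where `R_{t+1} = (1 - κ B_t) R_t + ‖u_t‖² / d`
(`run_chainStep_gap_le`). The two summands are controlled separately.

Conditionally on the past, the moments of `B_t` do not depend on the gradient, by rotation
invariance: the mean is `1 / d` and the second moment at most `3 / d²`
(`integral_cos_pow_four_le`). Hence `exp (-d B_t / 4)` has conditional mean at most `27 / 32`, and
Markov's inequality for `exp (-(d / 4) ∑ B_t)` shows that the first summand is at most `ε / 2` up to
probability `δ / 3` (`measure_contraction_gt_le`).

For the second summand, `exp (R_t / 64)` satisfies a Foster–Lyapunov drift condition with threshold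
`8 d / κ` (`lintegral_exp_bias_step_le`), so that its expectation is bounded uniformly in `t`
(`lintegral_exp_bias_le`). Markov's inequality then gives `q R_T ≤ ε / 2` up to probability
`2 δ / 3` as soon as `q (d L / μ + log (1 / δ))` is a small multiple of `ε`
(`measure_bias_gt_le`). No union bound over the iterations is needed; the term `log log T` in the
radius bound only has to be bounded below.

The process `(x_t, ∑ B_s, R_t)` is a Markov chain driven by the independent directions, so both
expectations are computed by integrating out the last direction first (`lintegral_run_succ`).
-/

noncomputable section

namespace ZerothOrder

section

variable {d : ℕ} {L μ : ℝ} {f : EuclideanSpace ℝ (Fin d) → ℝ}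

/-! ### Smooth strongly convex functions -/

theorem StronglyConvex.add_inner_le (hμ : 0 < μ) (h : StronglyConvex μ f)
    (x y : EuclideanSpace ℝ (Fin d)) :
    f x + inner ℝ (gradient f x) (y - x) ≤ f y := by
  have h1 := h x y
  have h2 : 0 ≤ μ / 2 * ‖y - x‖ ^ 2 := by positivity
  linarith

/-- A weak form of the descent lemma, with `L` in place of `L / 2`: for convex functions it follows
from the gradient inequality at the other endpoint, without integrating along the segment. -/
theorem le_add_inner_add_sq (hμ : 0 < μ) (hf : LipschitzGradient L f) (h : StronglyConvex μ f)
    (x y : EuclideanSpace ℝ (Fin d)) :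
    f y ≤ f x + inner ℝ (gradient f x) (y - x) + L * ‖y - x‖ ^ 2 := by
  have h1 := h.add_inner_le hμ y x
  have h2 : inner ℝ (gradient f y - gradient f x) (y - x) ≤ L * ‖y - x‖ ^ 2 := by
    refine (real_inner_le_norm _ _).trans ?_
    have := mul_le_mul_of_nonneg_right (hf.2 x y) (norm_nonneg (y - x))
    nlinarith
  have h3 : inner ℝ (gradient f y) (x - y) = -inner ℝ (gradient f y) (y - x) := by
    rw [← inner_neg_right, neg_sub]
  rw [inner_sub_left] at h2
  linarith

theorem modulus_le_lipschitz (hd : 1 ≤ d) (hf : LipschitzGradient L f)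
    (h : StronglyConvex μ f) : μ ≤ L := by
  set y : EuclideanSpace ℝ (Fin d) := EuclideanSpace.single ⟨0, hd⟩ 1
  have hy : ‖y‖ = 1 := by simp [y]
  have h1 := h 0 y
  have h2 := h y 0
  have h3 : inner ℝ (gradient f y - gradient f 0) y ≤ L := by
    refine (real_inner_le_norm _ _).trans ?_
    have := hf.2 0 y
    rw [sub_zero, hy] at this
    rw [hy]
    linarith
  rw [inner_sub_left] at h3
  simp only [sub_zero, zero_sub, inner_neg_right, norm_neg, hy] at h1 h2
  linarith

/-- The Polyak–Łojasiewicz inequality. -/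
theorem StronglyConvex.two_mul_sub_le (hμ : 0 < μ) (h : StronglyConvex μ f)
    (x y : EuclideanSpace ℝ (Fin d)) :
    2 * μ * (f x - f y) ≤ ‖gradient f x‖ ^ 2 := by
  have h1 := h x y
  have h2 := neg_le_of_abs_le (abs_real_inner_le_norm (gradient f x) (y - x))
  nlinarith [sq_nonneg (‖gradient f x‖ - μ * ‖y - x‖)]

theorem exists_unique_minimizer (hμ : 0 < μ) (hf : LipschitzGradient L f)
    (h : StronglyConvex μ f) :
    ∃ xs : EuclideanSpace ℝ (Fin d), ∀ y, y ≠ xs → f xs < f y := by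
  have hcoer : Filter.Tendsto f (Filter.cocompact (EuclideanSpace ℝ (Fin d))) Filter.atTop := by
    have hq : Filter.Tendsto (fun r : ℝ => f 0 + r * (μ / 2 * r - ‖gradient f 0‖))
        Filter.atTop Filter.atTop := by
      refine Filter.tendsto_atTop_add_const_left _ _ ?_
      refine Filter.tendsto_id.atTop_mul_atTop₀ ?_
      refine Filter.tendsto_atTop_add_const_right _ _ ?_
      exact Filter.tendsto_id.const_mul_atTop (by positivity)
    refine Filter.tendsto_atTop_mono (fun y => ?_)
      (hq.comp (tendsto_norm_cocompact_atTop (E := EuclideanSpace ℝ (Fin d))))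
    have h1 := h 0 y
    have h2 := neg_le_of_abs_le (abs_real_inner_le_norm (gradient f 0) y)
    simp only [sub_zero] at h1
    simp only [Function.comp]
    nlinarith
  obtain ⟨xs, hxs⟩ := hf.1.continuous.exists_forall_le hcoer
  refine ⟨xs, fun y hy => ?_⟩
  have hg : gradient f xs = 0 := by
    have hmin : IsLocalMin f xs := Filter.Eventually.of_forall hxs
    simp [gradient, hmin.fderiv_eq_zero]
  have h1 := h xs y
  have h2 : 0 < ‖y - xs‖ := norm_pos_iff.2 (sub_ne_zero.2 hy)
  have h3 : 0 < μ / 2 * ‖y - xs‖ ^ 2 := by positivity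
  rw [hg, inner_zero_left] at h1
  linarith

theorem LipschitzGradient.continuous_gradient (hf : LipschitzGradient L f) :
    Continuous (gradient f) := by
  refine (LipschitzWith.of_dist_le_mul (K := L.toNNReal) fun x y => ?_).continuous
  rw [dist_eq_norm, dist_eq_norm]
  refine (hf.2 y x).trans ?_
  exact mul_le_mul_of_nonneg_right (Real.le_coe_toNNReal L) (norm_nonneg _)

/-! ### One step of the method -/

/-- The squared cosine of the angle between a unit vector `w` and `u`, with value `0` at `u = 0`. -/
def sqCos (w u : EuclideanSpace ℝ (Fin d)) : ℝ := (inner ℝ w u / ‖u‖) ^ 2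

theorem sqCos_nonneg (w u : EuclideanSpace ℝ (Fin d)) : 0 ≤ sqCos w u := sq_nonneg _

theorem sqCos_le_one {w : EuclideanSpace ℝ (Fin d)} (hw : ‖w‖ = 1)
    (u : EuclideanSpace ℝ (Fin d)) : sqCos w u ≤ 1 := by
  have h := abs_real_inner_div_norm_mul_norm_le_one w u
  rw [hw, one_mul] at h
  rw [sqCos, ← sq_abs]
  exact pow_le_one₀ (abs_nonneg _) h

/-- The normalization of `g`, with the fallback direction `e` when `g = 0`, so that it is a unit vector
whenever `e` is. -/
def unitDir (e g : EuclideanSpace ℝ (Fin d)) : EuclideanSpace ℝ (Fin d) :=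
  if g = 0 then e else ‖g‖⁻¹ • g

theorem norm_unitDir {e : EuclideanSpace ℝ (Fin d)} (he : ‖e‖ = 1)
    (g : EuclideanSpace ℝ (Fin d)) : ‖unitDir e g‖ = 1 := by
  unfold unitDir
  split_ifs with h
  · exact he
  · exact norm_smul_inv_norm (𝕜 := ℝ) h

theorem norm_sq_mul_sqCos_unitDir (e g u : EuclideanSpace ℝ (Fin d)) :
    ‖g‖ ^ 2 * sqCos (unitDir e g) u = (inner ℝ g u / ‖u‖) ^ 2 := by
  unfold unitDir sqCos
  split_ifs with h
  · simp [h]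
  · have : ‖g‖ ≠ 0 := norm_ne_zero_iff.2 h
    rw [real_inner_smul_left]
    field_simp

/-- The point reached from `x` by one step of zeroth-order gradient descent along `u`. -/
def nextIterate (f : EuclideanSpace ℝ (Fin d) → ℝ) (L α : ℝ) (x u : EuclideanSpace ℝ (Fin d)) :
    EuclideanSpace ℝ (Fin d) :=
  x - (1 / (4 * L * ‖u‖ ^ 2)) • (((f (x + α • u) - f (x - α • u)) / (2 * α)) • u)

/-- The bias of the two-point estimator of the directional derivative. -/
theorem abs_two_point_sub_le {α : ℝ} (hα : 0 < α) (hμ : 0 < μ) (hf : LipschitzGradient L f)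
    (h : StronglyConvex μ f) (x u : EuclideanSpace ℝ (Fin d)) :
    |(f (x + α • u) - f (x - α • u)) / (2 * α) - inner ℝ (gradient f x) u| ≤
      L * α * ‖u‖ ^ 2 / 2 := by
  have h1 := h.add_inner_le hμ x (x + α • u)
  have h2 := h.add_inner_le hμ x (x - α • u)
  have h3 := le_add_inner_add_sq hμ hf h x (x + α • u)
  have h4 := le_add_inner_add_sq hμ hf h x (x - α • u)
  have e1 : x + α • u - x = α • u := by abel
  have e2 : x - α • u - x = -(α • u) := by abel
  rw [e1, inner_smul_right] at h1 h3
  rw [e2, inner_neg_right, inner_smul_right] at h2 h4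
  rw [norm_neg] at h4
  rw [norm_smul, Real.norm_of_nonneg hα.le, mul_pow] at h3 h4
  have e3 : (f (x + α • u) - f (x - α • u)) / (2 * α) - inner ℝ (gradient f x) u =
      (f (x + α • u) - f (x - α • u) - 2 * (α * inner ℝ (gradient f x) u)) / (2 * α) := by
    field_simp
  rw [e3, abs_div, abs_of_pos (by positivity : 0 < 2 * α), div_le_iff₀ (by positivity), abs_le]
  constructor <;> nlinarith

/-- One step decreases `f` by a multiple of the squared directional derivative along `u / ‖u‖`,
up to the bias of the two-point estimator. -/
theorem nextIterate_descent {α : ℝ} (hα : 0 < α) (hL : 0 < L) (hμ : 0 < μ)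
    (hf : LipschitzGradient L f) (h : StronglyConvex μ f) (x u : EuclideanSpace ℝ (Fin d)) :
    f (nextIterate f L α x u) ≤
      f x - (inner ℝ (gradient f x) u / ‖u‖) ^ 2 / (8 * L) + L * α ^ 2 * ‖u‖ ^ 2 / 32 := by
  rcases eq_or_ne u 0 with rfl | hu
  · simp [nextIterate]
  have hu0 : 0 < ‖u‖ := norm_pos_iff.2 hu
  have hD := abs_two_point_sub_le hα hμ hf h x u
  have hup := le_add_inner_add_sq hμ hf h x (nextIterate f L α x u)
  set D := (f (x + α • u) - f (x - α • u)) / (2 * α) with hDdef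
  have e1 : nextIterate f L α x u - x = -((D / (4 * L * ‖u‖ ^ 2)) • u) := by
    rw [nextIterate, ← hDdef, smul_smul, sub_sub_cancel_left]
    congr 2
    ring
  rw [e1, inner_neg_right, inner_smul_right, norm_neg, norm_smul, mul_pow, Real.norm_eq_abs,
    sq_abs] at hup
  set a := inner ℝ (gradient f x) u / ‖u‖ with ha
  have ea : inner ℝ (gradient f x) u = a * ‖u‖ := by rw [ha]; field_simp
  rw [ea] at hup hD
  obtain ⟨e, he⟩ : ∃ e, D = (a + e) * ‖u‖ := ⟨D / ‖u‖ - a, by field_simp; ring⟩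
  rw [he] at hup hD
  have he2 : e ^ 2 ≤ L ^ 2 * α ^ 2 * ‖u‖ ^ 2 / 4 := by
    have e4 : (a + e) * ‖u‖ - a * ‖u‖ = e * ‖u‖ := by ring
    rw [e4, abs_mul, abs_of_pos hu0] at hD
    have h5 : |e| ≤ L * α * ‖u‖ / 2 := by
      refine le_of_mul_le_mul_right ?_ hu0
      linarith
    calc e ^ 2 = |e| ^ 2 := (sq_abs e).symm
      _ ≤ (L * α * ‖u‖ / 2) ^ 2 := by gcongr
      _ = _ := by ring
  have e5 : (a + e) * ‖u‖ / (4 * L * ‖u‖ ^ 2) * (a * ‖u‖) = (a + e) * a / (4 * L) := by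
    field_simp
  have e6 : L * (((a + e) * ‖u‖ / (4 * L * ‖u‖ ^ 2)) ^ 2 * ‖u‖ ^ 2) = (a + e) ^ 2 / (16 * L) := by
    field_simp
    norm_num
  rw [e5, e6] at hup
  have e7 : f x + -((a + e) * a / (4 * L)) + (a + e) ^ 2 / (16 * L) ≤
      f x - a ^ 2 / (8 * L) + e ^ 2 / (8 * L) := by
    have : f x - a ^ 2 / (8 * L) + e ^ 2 / (8 * L) -
        (f x + -((a + e) * a / (4 * L)) + (a + e) ^ 2 / (16 * L)) = (a + e) ^ 2 / (16 * L) := by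
      field_simp
      ring
    have h8 : 0 ≤ (a + e) ^ 2 / (16 * L) := by positivity
    linarith
  have e8 : e ^ 2 / (8 * L) ≤ L * α ^ 2 * ‖u‖ ^ 2 / 32 := by
    rw [div_le_iff₀ (by positivity)]
    nlinarith
  linarith

/-- The optimality gap contracts by the factor `1 - μ / (4 L) * sqCos`, up to the bias. -/
theorem nextIterate_gap_le {α : ℝ} (hα : 0 < α) (hL : 0 < L) (hμ : 0 < μ)
    (hf : LipschitzGradient L f) (h : StronglyConvex μ f) (e xs x u : EuclideanSpace ℝ (Fin d)) :
    f (nextIterate f L α x u) - f xs ≤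
      (1 - μ / (4 * L) * sqCos (unitDir e (gradient f x)) u) * (f x - f xs) +
        L * α ^ 2 * ‖u‖ ^ 2 / 32 := by
  have h1 := nextIterate_descent hα hL hμ hf h x u
  rw [← norm_sq_mul_sqCos_unitDir e] at h1
  have h2 := mul_le_mul_of_nonneg_right (h.two_mul_sub_le hμ x xs)
    (sqCos_nonneg (unitDir e (gradient f x)) u)
  set B := sqCos (unitDir e (gradient f x)) u
  have h3 : 2 * μ * (f x - f xs) * B / (8 * L) ≤ ‖gradient f x‖ ^ 2 * B / (8 * L) := by gcongr
  have h4 : μ / (4 * L) * B * (f x - f xs) = 2 * μ * (f x - f xs) * B / (8 * L) := by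
    field_simp
    ring
  linarith

end

section

variable {d : ℕ}

/-! ### The direction of a standard Gaussian vector -/

theorem measurable_sqCos {Ω : Type*} [MeasurableSpace Ω] {w u : Ω → EuclideanSpace ℝ (Fin d)}
    (hw : Measurable w) (hu : Measurable u) : Measurable fun ω => sqCos (w ω) (u ω) :=
  ((hw.inner hu).div hu.norm).pow_const 2

theorem measurePreserving_coord (i : Fin d) :
    MeasurePreserving (fun u : EuclideanSpace ℝ (Fin d) => u i)
      (stdGaussian (EuclideanSpace ℝ (Fin d))) (gaussianReal 0 1) := by
  refine ⟨by fun_prop, ?_⟩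
  rw [← map_pi_eq_stdGaussian, Measure.map_map (by fun_prop) (by fun_prop)]
  exact (measurePreserving_eval (fun _ : Fin d => gaussianReal 0 1) i).map_eq

theorem ae_ne_zero_stdGaussian (hd : 1 ≤ d) :
    ∀ᵐ u ∂(stdGaussian (EuclideanSpace ℝ (Fin d))), u ≠ 0 := by
  have h : ∀ᵐ x ∂(gaussianReal 0 1), x ≠ 0 := by
    have := nullSingletonClass_gaussianReal (μ := 0) (v := 1) one_ne_zero
    simp [ae_iff]
  have h2 := (measurePreserving_coord (⟨0, hd⟩ : Fin d)).quasiMeasurePreserving.ae h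
  filter_upwards [h2] with u hu h0
  exact hu (by simp [h0])

/-- Rotation invariance: the law of `⟪w, u⟫ / ‖u‖` depends on `w` only through its norm. -/
theorem integral_comp_cos_eq (φ : ℝ → ℝ) {w w' : EuclideanSpace ℝ (Fin d)} (h : ‖w‖ = ‖w'‖) :
    ∫ u, φ (inner ℝ w u / ‖u‖) ∂(stdGaussian (EuclideanSpace ℝ (Fin d))) =
      ∫ u, φ (inner ℝ w' u / ‖u‖) ∂(stdGaussian (EuclideanSpace ℝ (Fin d))) := by
  set R : EuclideanSpace ℝ (Fin d) ≃ₗᵢ[ℝ] EuclideanSpace ℝ (Fin d) :=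
    (Submodule.span ℝ {w - w'})ᗮ.reflection with hR
  have hw : R w = w' := Submodule.reflection_sub h
  conv_rhs => rw [← stdGaussian_map R]
  rw [← hw]
  have := R.toHomeomorph.measurableEmbedding.integral_map
    (μ := stdGaussian (EuclideanSpace ℝ (Fin d))) (fun u => φ (inner ℝ (R w) u / ‖u‖))
  refine Eq.trans ?_ this.symm
  simp

theorem integrable_cos_pow (w : EuclideanSpace ℝ (Fin d)) (k : ℕ) :
    Integrable (fun u => (inner ℝ w u / ‖u‖) ^ k) (stdGaussian (EuclideanSpace ℝ (Fin d))) := by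
  have hm : Measurable fun u : EuclideanSpace ℝ (Fin d) => (inner ℝ w u / ‖u‖) ^ k := by fun_prop
  refine Integrable.of_bound (C := ‖w‖ ^ k) hm.aestronglyMeasurable (ae_of_all _ fun u => ?_)
  rw [norm_pow, Real.norm_eq_abs, abs_div, abs_norm]
  gcongr
  exact div_le_of_le_mul₀ (norm_nonneg _) (norm_nonneg _) (abs_real_inner_le_norm w u)

theorem sum_cos_sq (b : OrthonormalBasis (Fin d) ℝ (EuclideanSpace ℝ (Fin d)))
    {u : EuclideanSpace ℝ (Fin d)} (hu : u ≠ 0) :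
    ∑ i, (inner ℝ (b i) u / ‖u‖) ^ 2 = 1 := by
  have h := b.sum_sq_norm_inner_right u
  have h0 : ‖u‖ ≠ 0 := norm_ne_zero_iff.2 hu
  simp_rw [div_pow, ← Finset.sum_div]
  simp only [Real.norm_eq_abs, sq_abs] at h
  rw [h]
  field_simp

theorem integral_cos_sq (hd : 1 ≤ d) {w : EuclideanSpace ℝ (Fin d)} (hw : ‖w‖ = 1) :
    ∫ u, (inner ℝ w u / ‖u‖) ^ 2 ∂(stdGaussian (EuclideanSpace ℝ (Fin d))) = 1 / d := by
  have h1 : ∑ i, ∫ u, (inner ℝ (EuclideanSpace.basisFun (Fin d) ℝ i) u / ‖u‖) ^ 2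
      ∂(stdGaussian (EuclideanSpace ℝ (Fin d))) = 1 := by
    rw [← integral_finsetSum _ fun i _ => integrable_cos_pow _ 2]
    have : (fun u : EuclideanSpace ℝ (Fin d) =>
        ∑ i, (inner ℝ (EuclideanSpace.basisFun (Fin d) ℝ i) u / ‖u‖) ^ 2)
        =ᵐ[stdGaussian (EuclideanSpace ℝ (Fin d))] fun _ => 1 := by
      filter_upwards [ae_ne_zero_stdGaussian hd] with u hu
      exact sum_cos_sq _ hu
    rw [integral_congr_ae this]
    simp
  have h2 : ∀ i, ∫ u, (inner ℝ (EuclideanSpace.basisFun (Fin d) ℝ i) u / ‖u‖) ^ 2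
      ∂(stdGaussian (EuclideanSpace ℝ (Fin d))) =
      ∫ u, (inner ℝ w u / ‖u‖) ^ 2 ∂(stdGaussian (EuclideanSpace ℝ (Fin d))) := fun i =>
    integral_comp_cos_eq (fun t => t ^ 2) (by simp [hw])
  simp_rw [h2] at h1
  have hd0 : (d : ℝ) ≠ 0 := by positivity
  simp only [Finset.sum_const, Finset.card_univ, Fintype.card_fin, nsmul_eq_mul] at h1
  rw [eq_div_iff hd0, mul_comm]
  exact h1

theorem integral_cos_pow_four_eq {w w' : EuclideanSpace ℝ (Fin d)} (hw' : ‖w'‖ = 1) :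
    ∫ u, (inner ℝ w u / ‖u‖) ^ 4 ∂(stdGaussian (EuclideanSpace ℝ (Fin d))) =
      ‖w‖ ^ 4 * ∫ u, (inner ℝ w' u / ‖u‖) ^ 4 ∂(stdGaussian (EuclideanSpace ℝ (Fin d))) := by
  rw [integral_comp_cos_eq (fun t => t ^ 4) (w' := ‖w‖ • w') (by simp [norm_smul, hw']),
    ← integral_const_mul]
  congr 1 with u
  rw [real_inner_smul_left]
  ring

/-- The fourth moment is pinned down by rotation invariance: it is `a ‖w‖ ^ 4` for a constant `a`,
and averaging the identity `(s + t)⁴ + (s - t)⁴ = 2 s⁴ + 12 s² t² + 2 t⁴` over all pairs of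
coordinates `s, t` of `u / ‖u‖` gives a linear equation for `a`. -/
theorem integral_cos_pow_four_le (hd : 1 ≤ d) {w : EuclideanSpace ℝ (Fin d)} (hw : ‖w‖ = 1) :
    ∫ u, (inner ℝ w u / ‖u‖) ^ 4 ∂(stdGaussian (EuclideanSpace ℝ (Fin d))) ≤ 3 / (d : ℝ) ^ 2 := by
  set γ := stdGaussian (EuclideanSpace ℝ (Fin d))
  obtain ⟨b⟩ : Nonempty (OrthonormalBasis (Fin d) ℝ (EuclideanSpace ℝ (Fin d))) :=
    ⟨EuclideanSpace.basisFun (Fin d) ℝ⟩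
  set a := ∫ u, (inner ℝ w u / ‖u‖) ^ 4 ∂γ with ha
  have ha0 : 0 ≤ a := integral_nonneg fun u => by positivity
  have hsum : ∑ i, ∑ j, (∫ u, (inner ℝ (b i + b j) u / ‖u‖) ^ 4 ∂γ +
      ∫ u, (inner ℝ (b i - b j) u / ‖u‖) ^ 4 ∂γ) = 4 * (d : ℝ) ^ 2 * a + 12 := by
    have hI : ∀ i j, Integrable (fun u => (inner ℝ (b i + b j) u / ‖u‖) ^ 4 +
        (inner ℝ (b i - b j) u / ‖u‖) ^ 4) γ := fun i j =>
      (integrable_cos_pow _ 4).add (integrable_cos_pow _ 4)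
    rw [Finset.sum_congr rfl fun i _ => Finset.sum_congr rfl fun j _ =>
      (integral_add (integrable_cos_pow (b i + b j) 4) (integrable_cos_pow (b i - b j) 4)).symm]
    rw [Finset.sum_congr rfl fun i _ => (integral_finsetSum _ fun j _ => hI i j).symm]
    rw [← integral_finsetSum _ fun i _ => integrable_finsetSum _ fun j _ => hI i j]
    have hae : (fun u : EuclideanSpace ℝ (Fin d) => ∑ i, ∑ j,
        ((inner ℝ (b i + b j) u / ‖u‖) ^ 4 + (inner ℝ (b i - b j) u / ‖u‖) ^ 4)) =ᵐ[γ]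
        fun u => 4 * d * ∑ i, (inner ℝ (b i) u / ‖u‖) ^ 4 + 12 := by
      filter_upwards [ae_ne_zero_stdGaussian hd] with u hu
      have h1 : ∀ i j, (inner ℝ (b i + b j) u / ‖u‖) ^ 4 + (inner ℝ (b i - b j) u / ‖u‖) ^ 4 =
          2 * (inner ℝ (b i) u / ‖u‖) ^ 4 + 12 * ((inner ℝ (b i) u / ‖u‖) ^ 2 *
            (inner ℝ (b j) u / ‖u‖) ^ 2) + 2 * (inner ℝ (b j) u / ‖u‖) ^ 4 := by
        intro i j
        rw [inner_add_left, inner_sub_left]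
        ring
      simp_rw [h1, Finset.sum_add_distrib, ← Finset.mul_sum, sum_cos_sq b hu, mul_one]
      rw [sum_cos_sq b hu]
      simp only [Finset.sum_const, Finset.card_univ, Fintype.card_fin, nsmul_eq_mul,
        ← Finset.mul_sum]
      ring
    rw [integral_congr_ae hae, integral_add
      ((integrable_finsetSum _ fun i _ => integrable_cos_pow _ 4).const_mul _)
      (integrable_const _), integral_const_mul,
      integral_finsetSum _ fun i _ => integrable_cos_pow _ 4]
    have h2 : ∀ i, ∫ u, (inner ℝ (b i) u / ‖u‖) ^ 4 ∂γ = a := fun i =>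
      integral_comp_cos_eq (fun t => t ^ 4) (by simp [hw])
    rw [Finset.sum_congr rfl fun i _ => h2 i]
    simp
    ring
  have hlow : ∀ i j, 8 * a ≤ ∫ u, (inner ℝ (b i + b j) u / ‖u‖) ^ 4 ∂γ +
      ∫ u, (inner ℝ (b i - b j) u / ‖u‖) ^ 4 ∂γ := by
    intro i j
    rw [integral_cos_pow_four_eq hw, integral_cos_pow_four_eq hw (w := b i - b j), ← add_mul]
    refine mul_le_mul_of_nonneg_right ?_ ha0
    have hp := parallelogram_law_with_norm ℝ (b i) (b j)
    simp only [OrthonormalBasis.norm_eq_one] at hp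
    nlinarith [sq_nonneg (‖b i + b j‖ ^ 2 - ‖b i - b j‖ ^ 2)]
  have h3 : ∑ _i : Fin d, ∑ _j : Fin d, 8 * a ≤ 4 * (d : ℝ) ^ 2 * a + 12 := by
    rw [← hsum]
    exact Finset.sum_le_sum fun i _ => Finset.sum_le_sum fun j _ => hlow i j
  simp only [Finset.sum_const, Finset.card_univ, Fintype.card_fin, nsmul_eq_mul] at h3
  have hd0 : (0 : ℝ) < d := by positivity
  rw [le_div_iff₀ (by positivity)]
  nlinarith

theorem exp_neg_le_quadratic {y : ℝ} (hy : 0 ≤ y) : Real.exp (-y) ≤ 1 - y + y ^ 2 / 2 := by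
  have h1 := Real.quadratic_le_exp_of_nonneg hy
  have h2 : 0 < Real.exp y := Real.exp_pos y
  rw [Real.exp_neg, inv_le_iff_one_le_mul₀ h2]
  nlinarith [sq_nonneg (y ^ 2), mul_nonneg hy (sq_nonneg y), sq_nonneg (y - 1)]

/-- Above `d / 4` the bound is uniform in `s`: this is what makes the damping effective however large
the accumulated bias is. -/
theorem lintegral_exp_neg_sqCos_le (hd : 1 ≤ d) {w : EuclideanSpace ℝ (Fin d)} (hw : ‖w‖ = 1)
    {s : ℝ} (hs : d / 4 ≤ s) :
    ∫⁻ u, ENNReal.ofReal (Real.exp (-(s * sqCos w u)))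
      ∂(stdGaussian (EuclideanSpace ℝ (Fin d))) ≤ ENNReal.ofReal (27 / 32) := by
  have hd0 : (0 : ℝ) < d := by positivity
  have hint₂ : Integrable (fun u : EuclideanSpace ℝ (Fin d) =>
      1 - d / 4 * (inner ℝ w u / ‖u‖) ^ 2) (stdGaussian (EuclideanSpace ℝ (Fin d))) :=
    (integrable_const _).sub ((integrable_cos_pow w 2).const_mul _)
  have hint : Integrable (fun u : EuclideanSpace ℝ (Fin d) =>
      1 - d / 4 * (inner ℝ w u / ‖u‖) ^ 2 + (d / 4) ^ 2 / 2 * (inner ℝ w u / ‖u‖) ^ 4)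
      (stdGaussian (EuclideanSpace ℝ (Fin d))) :=
    hint₂.add ((integrable_cos_pow w 4).const_mul _)
  have hpt : ∀ u : EuclideanSpace ℝ (Fin d), Real.exp (-(s * sqCos w u)) ≤
      1 - d / 4 * (inner ℝ w u / ‖u‖) ^ 2 + (d / 4) ^ 2 / 2 * (inner ℝ w u / ‖u‖) ^ 4 := by
    intro u
    have h1 : Real.exp (-(s * sqCos w u)) ≤ Real.exp (-(d / 4 * sqCos w u)) := by
      gcongr
      exact sqCos_nonneg w u
    refine h1.trans ((exp_neg_le_quadratic (mul_nonneg (by positivity) (sqCos_nonneg w u))).trans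
      (le_of_eq ?_))
    rw [sqCos]
    ring
  refine (lintegral_mono fun u => ENNReal.ofReal_le_ofReal (hpt u)).trans ?_
  rw [← ofReal_integral_eq_lintegral_ofReal hint
    (ae_of_all _ fun u => (Real.exp_pos _).le.trans (hpt u))]
  refine ENNReal.ofReal_le_ofReal ?_
  rw [integral_add hint₂ ((integrable_cos_pow w 4).const_mul _),
    integral_sub (integrable_const _) ((integrable_cos_pow w 2).const_mul _),
    integral_const_mul, integral_const_mul, integral_cos_sq hd hw]
  have h4 := integral_cos_pow_four_le hd hw
  have h5 : ((d : ℝ) / 4) ^ 2 / 2 * ∫ u, (inner ℝ w u / ‖u‖) ^ 4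
      ∂(stdGaussian (EuclideanSpace ℝ (Fin d))) ≤ ((d : ℝ) / 4) ^ 2 / 2 * (3 / (d : ℝ) ^ 2) := by
    gcongr
  have h6 : ((d : ℝ) / 4) ^ 2 / 2 * (3 / (d : ℝ) ^ 2) = 3 / 32 := by field_simp; norm_num
  have h7 : (d : ℝ) / 4 * (1 / d) = 1 / 4 := by field_simp
  rw [h7]
  simp only [integral_const, probReal_univ, smul_eq_mul]
  linarith

/-! ### The length of a standard Gaussian vector -/

theorem lintegral_exp_sq_gaussianReal_le :
    ∫⁻ x, ENNReal.ofReal (Real.exp (x ^ 2 / 32)) ∂(gaussianReal 0 1) ≤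
      ENNReal.ofReal (16 / 15) := by
  rw [gaussianReal_of_var_ne_zero 0 one_ne_zero,
    lintegral_withDensity_eq_lintegral_mul _ (measurable_gaussianPDF 0 1) (by fun_prop)]
  have hpt : ∀ x : ℝ, (gaussianPDF 0 1 * fun x => ENNReal.ofReal (Real.exp (x ^ 2 / 32))) x =
      ENNReal.ofReal ((√(2 * Real.pi))⁻¹ * Real.exp (-(15 / 32) * x ^ 2)) := by
    intro x
    rw [Pi.mul_apply, gaussianPDF, ← ENNReal.ofReal_mul (gaussianPDFReal_nonneg _ _ _),
      gaussianPDFReal, mul_assoc, ← Real.exp_add]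
    congr 2
    · simp
    · congr 1
      simp
      ring
  simp_rw [hpt]
  rw [← ofReal_integral_eq_lintegral_ofReal
    ((integrable_exp_neg_mul_sq (by norm_num)).const_mul _) (ae_of_all _ fun x => by positivity),
    integral_const_mul, integral_gaussian]
  refine ENNReal.ofReal_le_ofReal ?_
  rw [← Real.sqrt_inv, ← Real.sqrt_mul (by positivity), Real.sqrt_le_left (by norm_num)]
  field_simp
  norm_num

/-- The exponential moment of `‖u‖² / d` is at most that of one squared coordinate, by convexity
of the exponential. -/
theorem lintegral_exp_norm_sq_le (hd : 1 ≤ d) :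
    ∫⁻ u, ENNReal.ofReal (Real.exp (‖u‖ ^ 2 / d / 32))
      ∂(stdGaussian (EuclideanSpace ℝ (Fin d))) ≤ ENNReal.ofReal (16 / 15) := by
  have hd0 : (0 : ℝ) < d := by positivity
  have hpt : ∀ u : EuclideanSpace ℝ (Fin d), ENNReal.ofReal (Real.exp (‖u‖ ^ 2 / d / 32)) ≤
      ∑ i, ENNReal.ofReal (1 / d) * ENNReal.ofReal (Real.exp (u i ^ 2 / 32)) := by
    intro u
    simp_rw [← ENNReal.ofReal_mul (by positivity : (0 : ℝ) ≤ 1 / d)]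
    rw [← ENNReal.ofReal_sum_of_nonneg fun i _ => by positivity]
    refine ENNReal.ofReal_le_ofReal ?_
    have h := convexOn_exp.map_sum_le (t := Finset.univ) (w := fun _ : Fin d => 1 / (d : ℝ))
      (p := fun i => u i ^ 2 / 32) (fun i _ => by positivity) (by simp [hd0.ne'])
      (fun i _ => Set.mem_univ _)
    simp only [smul_eq_mul] at h
    refine le_trans (le_of_eq ?_) h
    rw [EuclideanSpace.real_norm_sq_eq, ← Finset.mul_sum, ← Finset.sum_div]
    congr 1
    ring
  refine (lintegral_mono hpt).trans ?_
  rw [lintegral_finsetSum _ fun i _ => by fun_prop]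
  have h1 : ∀ i : Fin d, ∫⁻ u, ENNReal.ofReal (1 / d) * ENNReal.ofReal (Real.exp (u i ^ 2 / 32))
      ∂(stdGaussian (EuclideanSpace ℝ (Fin d))) ≤
      ENNReal.ofReal (1 / d) * ENNReal.ofReal (16 / 15) := by
    intro i
    rw [lintegral_const_mul _ (by fun_prop)]
    gcongr
    rw [(measurePreserving_coord i).lintegral_comp
      (f := fun x => ENNReal.ofReal (Real.exp (x ^ 2 / 32))) (by fun_prop)]
    exact lintegral_exp_sq_gaussianReal_le
  refine (Finset.sum_le_sum fun i _ => h1 i).trans (le_of_eq ?_)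
  rw [Finset.sum_const, Finset.card_univ, Fintype.card_fin, nsmul_eq_mul,
    ← ENNReal.ofReal_mul (by positivity), ← ENNReal.ofReal_natCast, ← ENNReal.ofReal_mul hd0.le]
  congr 1
  field_simp

end

section

/-! ### Markov chains driven by independent noise -/

/-- The state after `T` steps of the recursion `s ↦ F s (v t)` started at `s₀`. -/
def run {S N : Type*} (F : S → N → S) (s₀ : S) : (T : ℕ) → (Fin T → N) → S
  | 0, _ => s₀
  | T + 1, v => F (run F s₀ T (Fin.init v)) (v (Fin.last T))

section Chain

variable {S N : Type*} [MeasurableSpace S] [MeasurableSpace N] {F : S → N → S}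

theorem measurable_run (hF : Measurable (Function.uncurry F)) (s₀ : S) (T : ℕ) :
    Measurable (run F s₀ T) := by
  induction T with
  | zero => exact measurable_const
  | succ T ih =>
    have h1 : Measurable fun v : Fin (T + 1) → N => (Fin.init v : Fin T → N) :=
      measurable_pi_lambda _ fun i => measurable_pi_apply _
    exact hF.comp ((ih.comp h1).prodMk (measurable_pi_apply _))

/-- The Markov property, in the form of an iterated integral. -/
theorem lintegral_run_succ (hF : Measurable (Function.uncurry F)) (s₀ : S) (T : ℕ)
    (γ : Measure N) [IsProbabilityMeasure γ] {V : S → ENNReal} (hV : Measurable V) :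
    ∫⁻ v, V (run F s₀ (T + 1) v) ∂(Measure.pi fun _ : Fin (T + 1) => γ) =
      ∫⁻ w, ∫⁻ u, V (F (run F s₀ T w) u) ∂γ ∂(Measure.pi fun _ : Fin T => γ) := by
  have hg : Measurable fun p : N × (Fin T → N) => V (F (run F s₀ T p.2) p.1) :=
    hV.comp (hF.comp (((measurable_run hF s₀ T).comp measurable_snd).prodMk measurable_fst))
  have h := (measurePreserving_piFinSuccAbove (fun _ : Fin (T + 1) => γ) (Fin.last T)).lintegral_comp
    hg
  rw [← lintegral_prod_symm _ hg.aemeasurable, ← h]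
  congr 1 with v
  simp [run, MeasurableEquiv.piFinSuccAbove, Fin.insertNthEquiv, Fin.removeNth_last]

theorem lintegral_run_le_pow (hF : Measurable (Function.uncurry F)) (s₀ : S) (T : ℕ)
    (γ : Measure N) [IsProbabilityMeasure γ] {V : S → ENNReal} (hV : Measurable V) {r : ENNReal}
    (h : ∀ s, ∫⁻ u, V (F s u) ∂γ ≤ r * V s) :
    ∫⁻ v, V (run F s₀ T v) ∂(Measure.pi fun _ : Fin T => γ) ≤ r ^ T * V s₀ := by
  induction T with
  | zero => simp [run]
  | succ T ih =>
    have hm : Measurable fun w => V (run F s₀ T w) := hV.comp (measurable_run hF s₀ T)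
    rw [lintegral_run_succ hF s₀ T γ hV]
    calc _ ≤ ∫⁻ w, r * V (run F s₀ T w) ∂(Measure.pi fun _ : Fin T => γ) :=
          lintegral_mono fun w => h _
      _ = r * ∫⁻ w, V (run F s₀ T w) ∂(Measure.pi fun _ : Fin T => γ) :=
          lintegral_const_mul _ hm
      _ ≤ r * (r ^ T * V s₀) := by gcongr
      _ = r ^ (T + 1) * V s₀ := by ring

/-- A Foster–Lyapunov drift condition bounds the expectation uniformly in time. -/
theorem lintegral_run_le_of_drift (hF : Measurable (Function.uncurry F)) {s₀ : S} (T : ℕ)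
    (γ : Measure N) [IsProbabilityMeasure γ] {V : S → ENNReal} (hV : Measurable V)
    {r b K : ENNReal} (h : ∀ s, ∫⁻ u, V (F s u) ∂γ ≤ r * V s + b) (h₀ : V s₀ ≤ K)
    (hK : r * K + b ≤ K) :
    ∫⁻ v, V (run F s₀ T v) ∂(Measure.pi fun _ : Fin T => γ) ≤ K := by
  induction T with
  | zero => simpa [run] using h₀
  | succ T ih =>
    have hm : Measurable fun w => V (run F s₀ T w) := hV.comp (measurable_run hF s₀ T)
    rw [lintegral_run_succ hF s₀ T γ hV]
    calc _ ≤ ∫⁻ w, (r * V (run F s₀ T w) + b) ∂(Measure.pi fun _ : Fin T => γ) :=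
          lintegral_mono fun w => h _
      _ = r * ∫⁻ w, V (run F s₀ T w) ∂(Measure.pi fun _ : Fin T => γ) + b := by
          rw [lintegral_add_right _ measurable_const,
            lintegral_const_mul _ hm]
          simp
      _ ≤ r * K + b := by gcongr
      _ ≤ K := hK

end Chain

/-! ### The iterates as a Markov chain -/

variable {d : ℕ} {L μ α : ℝ} {f : EuclideanSpace ℝ (Fin d) → ℝ}

/-- The recursion for `(x, A, R)`: the iterate `x`, the accumulated squared cosines `A` of the angles
between the gradients and the search directions, and the accumulated bias `R`, which is damped by
the same factors `1 - κ * sqCos` as the optimality gap. -/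
def chainStep (f : EuclideanSpace ℝ (Fin d) → ℝ) (L α κ : ℝ) (e : EuclideanSpace ℝ (Fin d))
    (s : EuclideanSpace ℝ (Fin d) × ℝ × ℝ) (u : EuclideanSpace ℝ (Fin d)) :
    EuclideanSpace ℝ (Fin d) × ℝ × ℝ :=
  (nextIterate f L α s.1 u, s.2.1 + sqCos (unitDir e (gradient f s.1)) u,
    (1 - κ * sqCos (unitDir e (gradient f s.1)) u) * s.2.2 + ‖u‖ ^ 2 / d)

theorem measurable_nextIterate (hf : Measurable f) :
    Measurable (Function.uncurry (nextIterate f L α)) := by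
  have hp : Measurable fun p : EuclideanSpace ℝ (Fin d) × EuclideanSpace ℝ (Fin d) =>
      f (p.1 + α • p.2) := hf.comp (by fun_prop)
  have hm : Measurable fun p : EuclideanSpace ℝ (Fin d) × EuclideanSpace ℝ (Fin d) =>
      f (p.1 - α • p.2) := hf.comp (by fun_prop)
  have hη : Measurable fun p : EuclideanSpace ℝ (Fin d) × EuclideanSpace ℝ (Fin d) =>
      1 / (4 * L * ‖p.2‖ ^ 2) := by fun_prop
  have hg : Measurable fun p : EuclideanSpace ℝ (Fin d) × EuclideanSpace ℝ (Fin d) =>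
      ((f (p.1 + α • p.2) - f (p.1 - α • p.2)) / (2 * α)) • p.2 :=
    ((hp.sub hm).div_const _).smul measurable_snd
  exact measurable_fst.sub (hη.smul hg)

theorem measurable_unitDir (e : EuclideanSpace ℝ (Fin d)) : Measurable (unitDir e) := by
  unfold unitDir
  exact Measurable.ite (measurableSet_singleton 0) measurable_const (by fun_prop)

theorem measurable_chainStep (hf : LipschitzGradient L f) (α κ : ℝ)
    (e : EuclideanSpace ℝ (Fin d)) :
    Measurable (Function.uncurry (chainStep f L α κ e)) := by
  have hx : Measurable fun p : (EuclideanSpace ℝ (Fin d) × ℝ × ℝ) × EuclideanSpace ℝ (Fin d) =>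
      p.1.1 := measurable_fst.fst
  have hA : Measurable fun p : (EuclideanSpace ℝ (Fin d) × ℝ × ℝ) × EuclideanSpace ℝ (Fin d) =>
      p.1.2.1 := measurable_fst.snd.fst
  have hR : Measurable fun p : (EuclideanSpace ℝ (Fin d) × ℝ × ℝ) × EuclideanSpace ℝ (Fin d) =>
      p.1.2.2 := measurable_fst.snd.snd
  have hn : Measurable fun p : (EuclideanSpace ℝ (Fin d) × ℝ × ℝ) × EuclideanSpace ℝ (Fin d) =>
      ‖p.2‖ ^ 2 / d := by fun_prop
  have hw : Measurable fun p : (EuclideanSpace ℝ (Fin d) × ℝ × ℝ) × EuclideanSpace ℝ (Fin d) =>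
      unitDir e (gradient f p.1.1) :=
    (measurable_unitDir e).comp (hf.continuous_gradient.measurable.comp hx)
  have hB : Measurable fun p : (EuclideanSpace ℝ (Fin d) × ℝ × ℝ) × EuclideanSpace ℝ (Fin d) =>
      sqCos (unitDir e (gradient f p.1.1)) p.2 :=
    measurable_sqCos hw measurable_snd
  have hN : Measurable fun p : (EuclideanSpace ℝ (Fin d) × ℝ × ℝ) × EuclideanSpace ℝ (Fin d) =>
      nextIterate f L α p.1.1 p.2 :=
    (measurable_nextIterate hf.1.continuous.measurable).comp (hx.prodMk measurable_snd)
  exact hN.prodMk ((hA.add hB).prodMk ((((hB.const_mul κ).const_sub 1).mul hR).add hn))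

theorem run_chainStep_fst (f : EuclideanSpace ℝ (Fin d) → ℝ) (L α κ : ℝ)
    (e x₀ : EuclideanSpace ℝ (Fin d)) (u : ℕ → EuclideanSpace ℝ (Fin d)) (T : ℕ) :
    (run (chainStep f L α κ e) (x₀, 0, 0) T fun t => u t).1 = (zgd L α u x₀ T).output f := by
  induction T with
  | zero => rfl
  | succ T ih =>
    rw [zgd_output_succ, ← ih]
    rfl

theorem run_chainStep_angle_nonneg (f : EuclideanSpace ℝ (Fin d) → ℝ) (L α κ : ℝ)
    (e x₀ : EuclideanSpace ℝ (Fin d)) (T : ℕ) (v : Fin T → EuclideanSpace ℝ (Fin d)) :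
    0 ≤ (run (chainStep f L α κ e) (x₀, 0, 0) T v).2.1 := by
  induction T with
  | zero => exact le_rfl
  | succ T ih => exact add_nonneg (ih _) (sqCos_nonneg _ _)

/-- The optimality gap is controlled pathwise by the two auxiliary coordinates of the chain. -/
theorem run_chainStep_gap_le (hα : 0 < α) (hL : 0 < L) (hμ : 0 < μ) (hμL : μ ≤ L) (hd : 1 ≤ d)
    (hf : LipschitzGradient L f) (h : StronglyConvex μ f)
    {e : EuclideanSpace ℝ (Fin d)} (he : ‖e‖ = 1) {xs : EuclideanSpace ℝ (Fin d)}
    (hxs : ∀ y, f xs ≤ f y) (x₀ : EuclideanSpace ℝ (Fin d)) (T : ℕ)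
    (v : Fin T → EuclideanSpace ℝ (Fin d)) :
    f (run (chainStep f L α (μ / (4 * L)) e) (x₀, 0, 0) T v).1 - f xs ≤
      (f x₀ - f xs) *
          Real.exp (-(μ / (4 * L) * (run (chainStep f L α (μ / (4 * L)) e) (x₀, 0, 0) T v).2.1)) +
        L * α ^ 2 * d / 32 * (run (chainStep f L α (μ / (4 * L)) e) (x₀, 0, 0) T v).2.2 := by
  induction T with
  | zero => simp [run]
  | succ T ih =>
    specialize ih (Fin.init v)
    rw [run]
    set s := run (chainStep f L α (μ / (4 * L)) e) (x₀, 0, 0) T (Fin.init v)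
    set u := v (Fin.last T)
    have h1 := nextIterate_gap_le hα hL hμ hf h e xs s.1 u
    simp only [chainStep]
    set B := sqCos (unitDir e (gradient f s.1)) u
    set κ := μ / (4 * L)
    have hκ : κ ≤ 1 / 4 := by
      rw [div_le_div_iff₀ (by positivity) (by norm_num)]
      linarith
    have hκ0 : 0 < κ := by positivity
    have hB0 : 0 ≤ B := sqCos_nonneg _ _
    have hB1 : B ≤ 1 := sqCos_le_one (norm_unitDir he _) u
    -- The contraction factor is nonnegative, so the induction hypothesis may be multiplied by it.
    have hc : 0 ≤ 1 - κ * B := by nlinarith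
    have h2 := mul_le_mul_of_nonneg_left ih hc
    have h3 : (1 - κ * B) * Real.exp (-(κ * s.2.1)) ≤ Real.exp (-(κ * (s.2.1 + B))) := by
      have h4 : 1 - κ * B ≤ Real.exp (-(κ * B)) := Real.one_sub_le_exp_neg _
      calc _ ≤ Real.exp (-(κ * B)) * Real.exp (-(κ * s.2.1)) := by gcongr
        _ = _ := by rw [← Real.exp_add]; congr 1; ring
    have h5 := mul_le_mul_of_nonneg_left h3 (sub_nonneg.2 (hxs x₀))
    have hd0 : (0 : ℝ) < d := by positivity
    have h6 : L * α ^ 2 * d / 32 * (‖u‖ ^ 2 / d) = L * α ^ 2 * ‖u‖ ^ 2 / 32 := by field_simp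
    rw [mul_add (L * α ^ 2 * d / 32), h6]
    nlinarith

/-! ### Exponential moments along the chain -/

/-- The squared cosines accumulate at a linear rate, whatever the gradients are, because the bound on
their exponential moment is the same for all unit vectors. -/
theorem lintegral_exp_angle_le (hd : 1 ≤ d) (hf : LipschitzGradient L f) (α κ : ℝ)
    {e : EuclideanSpace ℝ (Fin d)} (he : ‖e‖ = 1) (x₀ : EuclideanSpace ℝ (Fin d)) (T : ℕ) :
    ∫⁻ v, ENNReal.ofReal (Real.exp (-(d / 4 * (run (chainStep f L α κ e) (x₀, 0, 0) T v).2.1)))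
      ∂(Measure.pi fun _ : Fin T => stdGaussian (EuclideanSpace ℝ (Fin d))) ≤
      ENNReal.ofReal (27 / 32) ^ T := by
  have key := lintegral_run_le_pow (measurable_chainStep hf α κ e) (x₀, 0, 0) T
    (stdGaussian (EuclideanSpace ℝ (Fin d)))
    (V := fun s => ENNReal.ofReal (Real.exp (-(d / 4 * s.2.1)))) (r := ENNReal.ofReal (27 / 32))
    (by fun_prop) ?_
  · simpa using key
  · intro s
    have h1 : ∀ u, ENNReal.ofReal (Real.exp (-(d / 4 * (chainStep f L α κ e s u).2.1))) =
        ENNReal.ofReal (Real.exp (-(d / 4 * s.2.1))) *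
          ENNReal.ofReal (Real.exp (-(d / 4 * sqCos (unitDir e (gradient f s.1)) u))) := by
      intro u
      rw [← ENNReal.ofReal_mul (Real.exp_pos _).le, ← Real.exp_add]
      congr 2
      simp only [chainStep]
      ring
    simp_rw [h1]
    rw [lintegral_const_mul' _ _ ENNReal.ofReal_ne_top, mul_comm]
    gcongr
    exact lintegral_exp_neg_sqCos_le hd (norm_unitDir he _) le_rfl

/-- The drift of `exp (R / 64)`: above the level `8 d / κ` the damping wins against the incoming
bias, and below it the next value is bounded outright. -/
theorem lintegral_exp_bias_step_le (hd : 1 ≤ d) (f : EuclideanSpace ℝ (Fin d) → ℝ) (L α : ℝ)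
    {κ : ℝ} (hκ0 : 0 < κ) (hκ1 : κ ≤ 1) {e : EuclideanSpace ℝ (Fin d)} (he : ‖e‖ = 1)
    (s : EuclideanSpace ℝ (Fin d) × ℝ × ℝ) :
    ∫⁻ u, ENNReal.ofReal (Real.exp ((chainStep f L α κ e s u).2.2 / 64))
      ∂(stdGaussian (EuclideanSpace ℝ (Fin d))) ≤
      ENNReal.ofReal (61 / 64 + 1 / 256) * ENNReal.ofReal (Real.exp (s.2.2 / 64)) +
        ENNReal.ofReal (Real.exp (8 * d / κ / 64) * (16 / 15)) := by
  have hd0 : (0 : ℝ) < d := by positivity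
  have hw := norm_unitDir he (gradient f s.1)
  simp only [chainStep]
  set w := unitDir e (gradient f s.1)
  set R := s.2.2
  rcases le_or_gt (8 * d / κ) R with hR | hR
  · refine le_trans ?_ (self_le_add_right _ _)
    rw [div_le_iff₀ hκ0] at hR
    -- `2 a b ≤ a² + b²` separates the direction of `u` from its length, so that their independence
    -- is not needed.
    have hpt : ∀ u : EuclideanSpace ℝ (Fin d),
        ENNReal.ofReal (Real.exp (((1 - κ * sqCos w u) * R + ‖u‖ ^ 2 / d) / 64)) ≤
        ENNReal.ofReal (Real.exp (R / 64) / 2) *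
          (ENNReal.ofReal (Real.exp (-(κ * R / 32 * sqCos w u))) +
            ENNReal.ofReal (Real.exp (‖u‖ ^ 2 / d / 32))) := by
      intro u
      rw [← ENNReal.ofReal_add (Real.exp_pos _).le (Real.exp_pos _).le,
        ← ENNReal.ofReal_mul (by positivity)]
      refine ENNReal.ofReal_le_ofReal ?_
      have e1 : Real.exp (((1 - κ * sqCos w u) * R + ‖u‖ ^ 2 / d) / 64) =
          Real.exp (R / 64) * (Real.exp (-(κ * R / 64 * sqCos w u)) *
            Real.exp (‖u‖ ^ 2 / d / 64)) := by
        rw [← Real.exp_add, ← Real.exp_add]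
        congr 1
        ring
      have e2 : Real.exp (-(κ * R / 32 * sqCos w u)) = Real.exp (-(κ * R / 64 * sqCos w u)) ^ 2 := by
        rw [← Real.exp_nat_mul]
        congr 1
        push_cast
        ring
      have e3 : Real.exp (‖u‖ ^ 2 / d / 32) = Real.exp (‖u‖ ^ 2 / d / 64) ^ 2 := by
        rw [← Real.exp_nat_mul]
        congr 1
        push_cast
        ring
      rw [e1, e2, e3]
      have h1 := two_mul_le_add_sq (Real.exp (-(κ * R / 64 * sqCos w u)))
        (Real.exp (‖u‖ ^ 2 / d / 64))
      have h2 := Real.exp_pos (R / 64)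
      nlinarith
    refine (lintegral_mono hpt).trans ?_
    rw [lintegral_const_mul' _ _ ENNReal.ofReal_ne_top, lintegral_add_right _ (by fun_prop)]
    have h1 := lintegral_exp_neg_sqCos_le hd hw (s := κ * R / 32) (by linarith)
    have h2 := lintegral_exp_norm_sq_le hd
    refine (mul_le_mul_right (add_le_add h1 h2) _).trans ?_
    rw [← ENNReal.ofReal_add (by norm_num) (by norm_num), ← ENNReal.ofReal_mul (by positivity),
      ← ENNReal.ofReal_mul (by norm_num)]
    refine ENNReal.ofReal_le_ofReal ?_
    have h3 := Real.exp_pos (R / 64)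
    nlinarith
  · refine le_trans ?_ (self_le_add_left _ _)
    have hpt : ∀ u : EuclideanSpace ℝ (Fin d),
        ENNReal.ofReal (Real.exp (((1 - κ * sqCos w u) * R + ‖u‖ ^ 2 / d) / 64)) ≤
        ENNReal.ofReal (Real.exp (8 * d / κ / 64)) *
          ENNReal.ofReal (Real.exp (‖u‖ ^ 2 / d / 32)) := by
      intro u
      rw [← ENNReal.ofReal_mul (Real.exp_pos _).le, ← Real.exp_add]
      refine ENNReal.ofReal_le_ofReal (Real.exp_le_exp.2 ?_)
      have hB0 : 0 ≤ sqCos w u := sqCos_nonneg _ _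
      have hB1 : sqCos w u ≤ 1 := sqCos_le_one hw u
      have hm : 0 < 8 * d / κ := by positivity
      have hc : 0 ≤ κ * sqCos w u := by positivity
      have hc1 : κ * sqCos w u ≤ 1 := mul_le_one₀ hκ1 hB0 hB1
      have h4 : (1 - κ * sqCos w u) * R ≤ 8 * d / κ := by
        nlinarith [mul_le_mul_of_nonneg_left hR.le (sub_nonneg.2 hc1)]
      have h5 : 0 ≤ ‖u‖ ^ 2 / d := by positivity
      linarith
    refine (lintegral_mono hpt).trans ?_
    rw [lintegral_const_mul' _ _ ENNReal.ofReal_ne_top, ENNReal.ofReal_mul (Real.exp_pos _).le]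
    gcongr
    exact lintegral_exp_norm_sq_le hd

theorem lintegral_exp_bias_le (hd : 1 ≤ d) (hf : LipschitzGradient L f) (α : ℝ)
    {κ : ℝ} (hκ0 : 0 < κ) (hκ1 : κ ≤ 1) {e : EuclideanSpace ℝ (Fin d)} (he : ‖e‖ = 1)
    (x₀ : EuclideanSpace ℝ (Fin d)) (T : ℕ) :
    ∫⁻ v, ENNReal.ofReal (Real.exp ((run (chainStep f L α κ e) (x₀, 0, 0) T v).2.2 / 64))
      ∂(Measure.pi fun _ : Fin T => stdGaussian (EuclideanSpace ℝ (Fin d))) ≤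
      ENNReal.ofReal (64 * Real.exp (8 * d / κ / 64)) := by
  have hd0 : (0 : ℝ) < d := by positivity
  refine lintegral_run_le_of_drift (measurable_chainStep hf α κ e) T
    (stdGaussian (EuclideanSpace ℝ (Fin d)))
    (V := fun s => ENNReal.ofReal (Real.exp (s.2.2 / 64))) (by fun_prop)
    (lintegral_exp_bias_step_le hd f L α hκ0 hκ1 he) ?_ ?_
  · refine ENNReal.ofReal_le_ofReal ?_
    have h1 : 1 ≤ Real.exp (8 * d / κ / 64) := Real.one_le_exp (by positivity)
    simp only [zero_div, Real.exp_zero]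
    linarith
  · rw [← ENNReal.ofReal_mul (by norm_num), ← ENNReal.ofReal_add (by positivity) (by positivity)]
    refine ENNReal.ofReal_le_ofReal ?_
    have h1 := Real.exp_pos (8 * d / κ / 64)
    nlinarith

end

section

variable {d : ℕ} {L μ α ε δ : ℝ} {f : EuclideanSpace ℝ (Fin d) → ℝ}

/-! ### The conditions on the horizon and the smoothing radius -/

theorem queries_zgd (f : EuclideanSpace ℝ (Fin d) → ℝ) (L α : ℝ)
    (u : ℕ → EuclideanSpace ℝ (Fin d)) (x₀ : EuclideanSpace ℝ (Fin d)) (T : ℕ) :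
    (zgd L α u x₀ T).queries f = 2 * T := by
  induction T with
  | zero => rfl
  | succ T ih =>
    rw [zgd, OracleAlg.queries_bind, ih]
    simp only [zgdStep, OracleAlg.queries]
    ring

/-- The case `T = 1` holds because `Real.log 0 = 0`; the worst case is `T = 2`. -/
theorem neg_half_le_log_log {T : ℕ} (hT : 1 ≤ T) : -(1 / 2) ≤ Real.log (Real.log (T : ℝ)) := by
  rcases hT.eq_or_lt with rfl | hT
  · simp
  have h1 : (0.69 : ℝ) ≤ Real.log T := by
    have h2 : Real.log 2 ≤ Real.log T :=
      Real.log_le_log (by norm_num) (by exact_mod_cast hT)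
    linarith [Real.log_two_gt_d9]
  have h3 := Real.one_sub_inv_le_log_of_pos (by linarith : 0 < Real.log (T : ℝ))
  have h4 : (Real.log (T : ℝ))⁻¹ ≤ (0.69 : ℝ)⁻¹ := by gcongr
  norm_num at h4
  linarith

theorem half_le_one_add_log_add_loglog (hδ0 : 0 < δ) (hδ1 : δ < 1) {T : ℕ} (hT : 1 ≤ T) :
    (1 + Real.log (1 / δ)) / 2 ≤ 1 + Real.log (1 / δ) + Real.log (Real.log (T : ℝ)) := by
  have h1 := neg_half_le_log_log hT
  have h2 : 0 ≤ Real.log (1 / δ) := Real.log_nonneg (by rw [le_div_iff₀ hδ0]; linarith)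
  linarith

theorem radiusBound_pos (hd : 1 ≤ d) (hL : 0 < L) (hμ : 0 < μ) (hε : 0 < ε) (hδ0 : 0 < δ)
    (hδ1 : δ < 1) {T : ℕ} (hT : 1 ≤ T) : 0 < radiusBound d L μ ε δ T := by
  have hd0 : (0 : ℝ) < d := by positivity
  have h1 := half_le_one_add_log_add_loglog hδ0 hδ1 hT
  have h2 : 0 ≤ Real.log (1 / δ) := Real.log_nonneg (by rw [le_div_iff₀ hδ0]; linarith)
  have h3 : 0 < 1 + Real.log (1 / δ) + Real.log (Real.log (T : ℝ)) := by linarith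
  exact lt_min (by positivity) (by positivity)

/-- An admissible smoothing radius makes the stationary level of the accumulated bias, and its
fluctuation at confidence `δ`, small against `ε`. -/
theorem bias_budget (hd : 1 ≤ d) (hL : 0 < L) (hμ : 0 < μ) (hε : 0 < ε) (hδ0 : 0 < δ)
    (hδ1 : δ < 1) {T : ℕ} (hT : 1 ≤ T) (hα : 0 < α)
    (hαr : α ≤ 1 / 10 * radiusBound d L μ ε δ T) :
    4 * L * α ^ 2 * d * (d * L / (2 * μ) + Real.log (96 / δ)) ≤ ε := by
  have hd0 : (0 : ℝ) < d := by positivity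
  have h1 := half_le_one_add_log_add_loglog hδ0 hδ1 hT
  have h2 : 0 ≤ Real.log (1 / δ) := Real.log_nonneg (by rw [le_div_iff₀ hδ0]; linarith)
  set W := 1 + Real.log (1 / δ) + Real.log (Real.log (T : ℝ)) with hW
  have hW0 : 0 < W := by linarith
  have ha : α ^ 2 * (d * L) ^ 2 ≤ ε * μ / 100 := by
    have h3 : α ≤ 1 / 10 * (√(ε * μ) / (d * L)) :=
      hαr.trans (mul_le_mul_of_nonneg_left (min_le_left _ _) (by norm_num))
    have h4 : α * (d * L) ≤ 1 / 10 * √(ε * μ) := by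
      rw [← mul_div_assoc, le_div_iff₀ (by positivity)] at h3
      exact h3
    have h5 := pow_le_pow_left₀ (by positivity) h4 2
    rw [mul_pow, mul_pow (1 / 10 : ℝ), Real.sq_sqrt (by positivity)] at h5
    linarith
  have hb : α ^ 2 * (d * L * W) ≤ ε / 100 := by
    have h3 : α ≤ 1 / 10 * √(ε / (d * L * W)) :=
      hαr.trans (mul_le_mul_of_nonneg_left (min_le_right _ _) (by norm_num))
    have h5 := pow_le_pow_left₀ hα.le h3 2
    rw [mul_pow, Real.sq_sqrt (by positivity), ← mul_div_assoc, le_div_iff₀ (by positivity)] at h5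
    linarith
  have hlog : Real.log (96 / δ) ≤ 5 * (1 + Real.log (1 / δ)) := by
    have h6 : Real.log 96 ≤ 5 := by
      rw [Real.log_le_iff_le_exp (by norm_num)]
      have h7 : Real.exp 5 = Real.exp 1 ^ 5 := by rw [← Real.exp_nat_mul]; norm_num
      have h8 : (2.7 : ℝ) ^ 5 ≤ Real.exp 1 ^ 5 := by
        gcongr
        linarith [Real.exp_one_gt_d9]
      rw [h7]
      norm_num at h8 ⊢
      linarith
    rw [Real.log_div (by norm_num) hδ0.ne']
    rw [one_div, Real.log_inv] at h2 ⊢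
    linarith
  have hc : 4 * L * α ^ 2 * d * (d * L / (2 * μ)) ≤ ε / 50 := by
    have : 4 * L * α ^ 2 * d * (d * L / (2 * μ)) = 2 * (α ^ 2 * (d * L) ^ 2) / μ := by
      field_simp
      ring
    rw [this, div_le_iff₀ hμ]
    linarith
  have hd' : 4 * L * α ^ 2 * d * Real.log (96 / δ) ≤ 2 / 5 * ε := by
    calc 4 * L * α ^ 2 * d * Real.log (96 / δ) ≤ 4 * L * α ^ 2 * d * (10 * W) := by
          gcongr
          linarith
      _ = 40 * (α ^ 2 * (d * L * W)) := by ring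
      _ ≤ 2 / 5 * ε := by linarith
  linarith

/-! ### Tail bounds -/

theorem measure_ge_le_of_lintegral_exp_le {Ω : Type*} [MeasurableSpace Ω] {P : Measure Ω}
    {g : Ω → ℝ} (hg : Measurable g) {t y : ℝ}
    (h : ∫⁻ ω, ENNReal.ofReal (Real.exp (g ω)) ∂P ≤ ENNReal.ofReal y) :
    P {ω | t ≤ g ω} ≤ ENNReal.ofReal (y * Real.exp (-t)) := by
  have h1 : {ω | t ≤ g ω} = {ω | ENNReal.ofReal (Real.exp t) ≤ ENNReal.ofReal (Real.exp (g ω))} := by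
    ext ω
    simp [ENNReal.ofReal_le_ofReal_iff (Real.exp_pos _).le]
  rw [h1]
  refine (meas_ge_le_lintegral_div (by fun_prop) (by simp [Real.exp_pos])
    ENNReal.ofReal_ne_top).trans ?_
  rw [Real.exp_neg, ← div_eq_mul_inv, ENNReal.ofReal_div_of_pos (Real.exp_pos t)]
  gcongr

/-- With an admissible horizon, the initial gap has been contracted below `ε / 2`. -/
theorem measure_contraction_gt_le (hd : 1 ≤ d) (hL : 0 < L) (hμ : 0 < μ)
    (hf : LipschitzGradient L f) (hε : 0 < ε) (hδ0 : 0 < δ) (hδ1 : δ < 1) (α : ℝ)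
    {e : EuclideanSpace ℝ (Fin d)} (he : ‖e‖ = 1) (x₀ : EuclideanSpace ℝ (Fin d)) {Δ₀ : ℝ} {T : ℕ}
    (hT : HorizonCondition d L μ Δ₀ ε δ T) :
    (Measure.pi fun _ : Fin T => stdGaussian (EuclideanSpace ℝ (Fin d)))
      {v | ε / 2 < Δ₀ * Real.exp (-(μ / (4 * L) *
        (run (chainStep f L α (μ / (4 * L)) e) (x₀, 0, 0) T v).2.1))} ≤
      ENNReal.ofReal (δ / 3) := by
  have hd0 : (0 : ℝ) < d := by positivity
  have hA := run_chainStep_angle_nonneg f L α (μ / (4 * L)) e x₀ T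
  have hκ : 0 < μ / (4 * L) := by positivity
  -- If `2 Δ₀ ≤ ε` the logarithm in the horizon condition is nonpositive and gives no lower bound on
  -- `T`, but then no contraction is needed.
  rcases le_or_gt Δ₀ (ε / 2) with hΔ | hΔ
  · refine le_of_eq_of_le ?_ zero_le
    rw [show {v | ε / 2 < Δ₀ * Real.exp (-(μ / (4 * L) *
        (run (chainStep f L α (μ / (4 * L)) e) (x₀, 0, 0) T v).2.1))} = ∅ from ?_, measure_empty]
    refine Set.eq_empty_of_forall_notMem fun v hv => ?_
    have h1 : Real.exp (-(μ / (4 * L) *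
        (run (chainStep f L α (μ / (4 * L)) e) (x₀, 0, 0) T v).2.1)) ≤ 1 :=
      Real.exp_le_one_iff.2 (neg_nonpos.2 (mul_nonneg hκ.le (hA v)))
    have h2 := Real.exp_pos (-(μ / (4 * L) *
        (run (chainStep f L α (μ / (4 * L)) e) (x₀, 0, 0) T v).2.1))
    rw [Set.mem_ofPred_eq] at hv
    nlinarith
  · have hΔ0 : 0 < Δ₀ := by linarith
    have hX := hT.2 hΔ0
    set ℓ := Real.log (2 * Δ₀ / ε) with hℓ
    have hℓ0 : 0 ≤ ℓ := Real.log_nonneg (by rw [le_div_iff₀ hε]; linarith)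
    have hmeas : Measurable fun v : Fin T → EuclideanSpace ℝ (Fin d) =>
        -(d / 4 * (run (chainStep f L α (μ / (4 * L)) e) (x₀, 0, 0) T v).2.1) :=
      (((measurable_run (measurable_chainStep hf α _ e) _ T).snd.fst).const_mul _).neg
    have hmom := lintegral_exp_angle_le hd hf α (μ / (4 * L)) he x₀ T
    rw [← ENNReal.ofReal_pow (by norm_num)] at hmom
    refine (measure_mono fun v hv => ?_).trans
      ((measure_ge_le_of_lintegral_exp_le hmeas (t := -(d * L / μ * ℓ)) hmom).trans
        (ENNReal.ofReal_le_ofReal ?_))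
    · rw [Set.mem_ofPred_eq] at hv ⊢
      set A := (run (chainStep f L α (μ / (4 * L)) e) (x₀, 0, 0) T v).2.1
      have h1 : Real.exp (μ / (4 * L) * A) < 2 * Δ₀ / ε := by
        rw [Real.exp_neg, ← div_eq_mul_inv, lt_div_iff₀ (Real.exp_pos _)] at hv
        rw [lt_div_iff₀ hε]
        linarith
      have h2 : μ / (4 * L) * A < ℓ := by
        rw [hℓ, Real.lt_log_iff_exp_lt (by positivity)]
        exact h1
      have h3 : d / 4 * A = d * L / μ * (μ / (4 * L) * A) := by field_simp
      rw [h3, neg_le_neg_iff]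
      gcongr
    · have h1 : (27 / 32 : ℝ) ^ T ≤ Real.exp (-(5 / 32 * T)) := by
        have h2 : (27 / 32 : ℝ) ≤ Real.exp (-(5 / 32)) := by
          linarith [Real.one_sub_le_exp_neg (5 / 32)]
        calc (27 / 32 : ℝ) ^ T ≤ Real.exp (-(5 / 32)) ^ T := by gcongr
          _ = Real.exp (-(5 / 32 * T)) := by
            rw [← Real.exp_nat_mul]
            congr 1
            ring
      have h3 : δ / 3 = Real.exp (-Real.log (3 / δ)) := by
        rw [← Real.log_inv, Real.exp_log (by positivity), inv_div]
      rw [neg_neg, h3]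
      calc _ ≤ Real.exp (-(5 / 32 * T)) * Real.exp (d * L / μ * ℓ) := by gcongr
        _ = Real.exp (-(5 / 32 * T) + d * L / μ * ℓ) := (Real.exp_add _ _).symm
        _ ≤ Real.exp (-Real.log (3 / δ)) := by
          refine Real.exp_le_exp.2 ?_
          have h4 : 16 * d * L / μ * ℓ = 16 * (d * L / μ * ℓ) := by ring
          have h5 : 0 ≤ d * L / μ * ℓ := by positivity
          have h6 : 0 ≤ Real.log (3 / δ) := Real.log_nonneg (by rw [le_div_iff₀ hδ0]; linarith)
          linarith

/-- With an admissible smoothing radius, the accumulated bias stays below `ε / 2`. -/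
theorem measure_bias_gt_le (hd : 1 ≤ d) (hL : 0 < L) (hμ : 0 < μ) (hμL : μ ≤ L)
    (hf : LipschitzGradient L f) (hε : 0 < ε) (hδ0 : 0 < δ) (hδ1 : δ < 1)
    {e : EuclideanSpace ℝ (Fin d)} (he : ‖e‖ = 1) (x₀ : EuclideanSpace ℝ (Fin d)) {T : ℕ}
    (hT : 1 ≤ T) (hα : 0 < α) (hαr : α ≤ 1 / 10 * radiusBound d L μ ε δ T) :
    (Measure.pi fun _ : Fin T => stdGaussian (EuclideanSpace ℝ (Fin d)))
      {v | ε / 2 < L * α ^ 2 * d / 32 *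
        (run (chainStep f L α (μ / (4 * L)) e) (x₀, 0, 0) T v).2.2} ≤
      ENNReal.ofReal (2 * δ / 3) := by
  have hd0 : (0 : ℝ) < d := by positivity
  have hκ : 0 < μ / (4 * L) := by positivity
  have hκ1 : μ / (4 * L) ≤ 1 := by
    rw [div_le_one (by positivity)]
    linarith
  have hmeas : Measurable fun v : Fin T → EuclideanSpace ℝ (Fin d) =>
      (run (chainStep f L α (μ / (4 * L)) e) (x₀, 0, 0) T v).2.2 / 64 :=
    ((measurable_run (measurable_chainStep hf α _ e) _ T).snd.snd).div_const _
  have hmom := lintegral_exp_bias_le hd hf α hκ hκ1 he x₀ T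
  have hq : 0 < L * α ^ 2 * d := by positivity
  refine (measure_mono fun v hv => ?_).trans
    ((measure_ge_le_of_lintegral_exp_le hmeas (t := ε / (4 * (L * α ^ 2 * d))) hmom).trans
      (ENNReal.ofReal_le_ofReal ?_))
  · rw [Set.mem_ofPred_eq] at hv ⊢
    rw [div_le_iff₀ (by positivity)]
    linarith
  · have h1 := bias_budget hd hL hμ hε hδ0 hδ1 hT hα hαr
    have h2 : d * L / (2 * μ) + Real.log (96 / δ) ≤ ε / (4 * (L * α ^ 2 * d)) := by
      rw [le_div_iff₀ (by positivity)]
      linarith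
    have h3 : 8 * d / (μ / (4 * L)) / 64 = d * L / (2 * μ) := by
      field_simp
      norm_num
    have h4 : 2 * δ / 3 = 64 * Real.exp (-Real.log (96 / δ)) := by
      rw [← Real.log_inv, Real.exp_log (by positivity), inv_div]
      ring
    rw [h3, h4, mul_assoc, ← Real.exp_add]
    gcongr
    linarith

theorem ofReal_le_measure_gap_le (hd : 1 ≤ d) (hL : 0 < L) (hμ : 0 < μ)
    (hf : LipschitzGradient L f) (h : StronglyConvex μ f) (hε : 0 < ε) (hδ0 : 0 < δ) (hδ1 : δ < 1)
    {xs : EuclideanSpace ℝ (Fin d)} (hxs : ∀ y, f xs ≤ f y) (x₀ : EuclideanSpace ℝ (Fin d)) {T : ℕ}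
    (hT : HorizonCondition d L μ (f x₀ - f xs) ε δ T) (hα : 0 < α)
    (hαr : α ≤ 1 / 10 * radiusBound d L μ ε δ T)
    {Ω : Type*} [MeasurableSpace Ω] (P : Measure Ω) [IsProbabilityMeasure P]
    (u : ℕ → Ω → EuclideanSpace ℝ (Fin d))
    (hu : ∀ t < T, HasLaw (u t) (stdGaussian (EuclideanSpace ℝ (Fin d))) P)
    (hind : iIndepFun (fun t : Fin T => u t) P) :
    ENNReal.ofReal (1 - δ) ≤
      P {ω | f ((zgd L α (fun t => u t ω) x₀ T).output f) - f xs ≤ ε} := by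
  have hμL := modulus_le_lipschitz hd hf h
  set e : EuclideanSpace ℝ (Fin d) := EuclideanSpace.single ⟨0, hd⟩ 1
  have he : ‖e‖ = 1 := by simp [e]
  set F := chainStep f L α (μ / (4 * L)) e
  have hlaw : HasLaw (fun ω (t : Fin T) => u t ω)
      (Measure.pi fun _ : Fin T => stdGaussian (EuclideanSpace ℝ (Fin d))) P :=
    hind.hasLaw_pi fun t => hu t t.2
  have hfm : Measurable f := hf.1.continuous.measurable
  have hmeas : MeasurableSet {v : Fin T → EuclideanSpace ℝ (Fin d) |
      f (run F (x₀, 0, 0) T v).1 - f xs ≤ ε} :=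
    measurableSet_le ((hfm.comp
      (measurable_run (measurable_chainStep hf α _ e) _ T).fst).sub_const _) measurable_const
  have hP := hlaw.measure_eq hmeas
  have hrun : ∀ ω, (run F (x₀, 0, 0) T fun t : Fin T => u t ω).1 =
      (zgd L α (fun t => u t ω) x₀ T).output f := fun ω =>
    run_chainStep_fst f L α (μ / (4 * L)) e x₀ (fun t => u t ω) T
  simp only [hrun] at hP
  rw [hP, ← compl_compl {v : Fin T → EuclideanSpace ℝ (Fin d) |
    f (run F (x₀, 0, 0) T v).1 - f xs ≤ ε}, prob_compl_eq_one_sub hmeas.compl,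
    ENNReal.ofReal_sub _ hδ0.le, ENNReal.ofReal_one]
  refine tsub_le_tsub_left ?_ _
  refine (measure_mono (t := {v | ε / 2 < (f x₀ - f xs) *
      Real.exp (-(μ / (4 * L) * (run F (x₀, 0, 0) T v).2.1))} ∪
      {v | ε / 2 < L * α ^ 2 * d / 32 * (run F (x₀, 0, 0) T v).2.2}) fun v hv => ?_).trans
    ((measure_union_le _ _).trans ((add_le_add
      (measure_contraction_gt_le hd hL hμ hf hε hδ0 hδ1 α he x₀ hT)
      (measure_bias_gt_le hd hL hμ hμL hf hε hδ0 hδ1 he x₀ hT.1 hα hαr)).trans ?_))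
  · have hgap := run_chainStep_gap_le hα hL hμ hμL hd hf h he hxs x₀ T v
    simp only [Set.mem_compl_iff, Set.mem_ofPred_eq, not_le] at hv
    simp only [Set.mem_union, Set.mem_ofPred_eq]
    by_contra! hcon
    linarith [hcon.1, hcon.2]
  · rw [← ENNReal.ofReal_add (by positivity) (by positivity)]
    exact ENNReal.ofReal_le_ofReal (by linarith)

/-! ### The query complexity -/

theorem exists_horizon (hd : 1 ≤ d) (hL : 0 < L) (hμ : 0 < μ) (hμL : μ ≤ L) (Δ₀ : ℝ) (hε0 : 0 < ε)
    (hε1 : ε < 1) (hδ0 : 0 < δ) (hδ1 : δ < 1) :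
    ∃ T : ℕ, HorizonCondition d L μ Δ₀ ε δ T ∧
      2 * (T : ℝ) ≤ 100 * (d * L / μ * (1 + Real.log (1 / ε) + Real.posLog Δ₀) +
        Real.log (1 / δ)) := by
  have hlδ : 0 ≤ Real.log (1 / δ) := Real.log_nonneg (by rw [le_div_iff₀ hδ0]; linarith)
  have hlε : 0 ≤ Real.log (1 / ε) := Real.log_nonneg (by rw [le_div_iff₀ hε0]; linarith)
  have hlΔ : 0 ≤ Real.posLog Δ₀ := Real.posLog_nonneg
  have hK : 1 ≤ d * L / μ := by
    have hd1 : (1 : ℝ) ≤ d := by exact_mod_cast hd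
    rw [le_div_iff₀ hμ]
    nlinarith
  set K := d * L / μ with hKdef
  set S := 1 + Real.log (1 / ε) + Real.posLog Δ₀ with hS
  have hS1 : 1 ≤ S := by linarith
  have hKS : 1 ≤ K * S := one_le_mul_of_one_le_of_one_le hK hS1
  refine ⟨⌈16 * (K * S) + 12 * (2 + Real.log (1 / δ))⌉₊ + 1, ⟨by omega, fun hΔ => ?_⟩, ?_⟩
  · push_cast
    refine le_trans ?_ ((Nat.le_ceil _).trans (le_add_of_nonneg_right zero_le_one))
    have h1 : Real.log (2 * Δ₀ / ε) ≤ S := by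
      rw [mul_div_assoc, Real.log_mul (by norm_num) (by positivity), div_eq_mul_one_div,
        Real.log_mul hΔ.ne' (by positivity)]
      have h2 : Real.log Δ₀ ≤ Real.posLog Δ₀ := le_max_right _ _
      linarith [Real.log_two_lt_d9]
    have h3 : Real.log (3 / δ) ≤ 2 + Real.log (1 / δ) := by
      rw [div_eq_mul_one_div, Real.log_mul (by norm_num) (by positivity)]
      linarith [Real.log_le_sub_one_of_pos (by norm_num : (0 : ℝ) < 3)]
    have h4 : 16 * d * L / μ * Real.log (2 * Δ₀ / ε) ≤ 16 * (K * S) := by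
      calc 16 * d * L / μ * Real.log (2 * Δ₀ / ε) = 16 * (K * Real.log (2 * Δ₀ / ε)) := by
            rw [hKdef]
            ring
        _ ≤ 16 * (K * S) := by gcongr
    linarith
  · have h1 := Nat.ceil_lt_add_one
      (by positivity : 0 ≤ 16 * (K * S) + 12 * (2 + Real.log (1 / δ)))
    push_cast
    linarith

end

end ZerothOrder

end

theorem mainTheorem2 :
    ∃ c : ℝ, 0 < c ∧ ∃ C : ℝ, 0 < C ∧
      ∀ (d : ℕ) (L μ : ℝ) (f : EuclideanSpace ℝ (Fin d) → ℝ),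
        1 ≤ d → 0 < L → 0 < μ →
        ZerothOrder.LipschitzGradient L f → ZerothOrder.StronglyConvex μ f →
        -- `xs` is the unique minimizer of `f`
        ∃ xs : EuclideanSpace ℝ (Fin d), (∀ y, y ≠ xs → f xs < f y) ∧
          ∀ (x₀ : EuclideanSpace ℝ (Fin d)) (ε δ : ℝ),
            0 < ε → ε < 1 → 0 < δ → δ < 1 →
            -- accuracy with high probability, from `2 T` queries
            (∀ (T : ℕ) (α : ℝ),
              ZerothOrder.HorizonCondition d L μ (f x₀ - f xs) ε δ T →
              0 < α → α ≤ c * ZerothOrder.radiusBound d L μ ε δ T →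
              (∀ (Ω : Type*) [MeasurableSpace Ω] (P : Measure Ω) [IsProbabilityMeasure P]
                (u : ℕ → Ω → EuclideanSpace ℝ (Fin d)),
                (∀ t < T, HasLaw (u t) (stdGaussian (EuclideanSpace ℝ (Fin d))) P) →
                iIndepFun (fun t : Fin T => u t) P →
                ENNReal.ofReal (1 - δ) ≤
                  P {ω | f ((ZerothOrder.zgd L α (fun t => u t ω) x₀ T).output f) - f xs ≤ ε}) ∧
              (∀ v : ℕ → EuclideanSpace ℝ (Fin d),
                (ZerothOrder.zgd L α v x₀ T).queries f = 2 * T)) ∧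
            -- query complexity of an admissible choice of `T` and `α`
            (∃ (T : ℕ) (α : ℝ),
              ZerothOrder.HorizonCondition d L μ (f x₀ - f xs) ε δ T ∧
              0 < α ∧ α ≤ c * ZerothOrder.radiusBound d L μ ε δ T ∧
              ∀ v : ℕ → EuclideanSpace ℝ (Fin d),
                ((ZerothOrder.zgd L α v x₀ T).queries f : ℝ) ≤
                  C * (d * L / μ * (1 + Real.log (1 / ε) + Real.posLog (f x₀ - f xs)) +
                    Real.log (1 / δ))) := by
  refine ⟨1 / 10, by norm_num, 100, by norm_num, ?_⟩
  intro d L μ f hd hL hμ hf h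
  obtain ⟨xs, hxs⟩ := ZerothOrder.exists_unique_minimizer hμ hf h
  have hmin : ∀ y, f xs ≤ f y := fun y => by
    rcases eq_or_ne y xs with rfl | hy
    · exact le_rfl
    · exact (hxs y hy).le
  refine ⟨xs, hxs, fun x₀ ε δ hε0 hε1 hδ0 hδ1 => ⟨fun T α hT hα hαr => ⟨?_, ?_⟩, ?_⟩⟩
  · intro Ω _ P _ u hu hind
    exact ZerothOrder.ofReal_le_measure_gap_le hd hL hμ hf h hε0 hδ0 hδ1 hmin x₀ hT hα hαr P u hu
      hind
  · exact fun v => ZerothOrder.queries_zgd f L α v x₀ T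
  · obtain ⟨T, hT, hTle⟩ := ZerothOrder.exists_horizon hd hL hμ
      (ZerothOrder.modulus_le_lipschitz hd hf h) (f x₀ - f xs) hε0 hε1 hδ0 hδ1
    have hr := ZerothOrder.radiusBound_pos hd hL hμ hε0 hδ0 hδ1 hT.1
    refine ⟨T, 1 / 10 * ZerothOrder.radiusBound d L μ ε δ T, hT, by positivity, le_rfl, fun v => ?_⟩
    rw [ZerothOrder.queries_zgd]
    push_cast
    exact hTle
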